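/- Let $S\subseteq\mathbb{R}^d$ be a nonempty compact polyhedron with (finite) set of extreme points $\mathfrak{S}$, and let $w^*:\mathbb{R}^d\to S$ be an optimization oracle, i.e. a fixed map with $w^*(c)\in\arg\min_{w\in S}c^Tw$ for every $c$. The SPO loss is $\ell_{\mathrm{SPO}}(\hat c,c):=c^T(w^*(\hat c)-w^*(c))$. Let $\mathcal{C}\subseteq\mathbb{R}^d$ be such that $\omega_S(\mathcal{C}):=\sup_{c\in\mathcal{C}}\bigl(\max_{w\in S}c^Tw-\min_{w\in S}c^Tw\bigr)<\infty$. Let $\mathcal{D}$ be a probability distribution of pairs $(x,c)$ with $x$ in a measurable space $\mathcal{X}$ (such as a subset of $\mathbb{R}^p$) and $c\in\mathcal{C}$ almost surely, let $n\ge 1$, and let $(x_1,c_1),\dots,(x_n,c_n)$ be an i.i.d. sample from $\mathcal{D}$. Let $\mathcal{H}$ be a family of functions $f:\mathcal{X}\to\mathbb{R}^d$ whose induced decision class $w^*(\mathcal{H}):=\{x\mapsto w^*(f(x)):f\in\mathcal{H}\}$ consists of functions from $\mathcal{X}$ to $\mathfrak{S}$. Assume that, up to null sets, each loss $(x,c)\mapsto\ell_{\mathrm{SPO}}(f(x),c)$,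 $f\in\mathcal{H}$, is measurable, and that so is $\sup_{f\in\mathcal{H}}\sum_{i=1}^m a_i\,\ell_{\mathrm{SPO}}(f(x_i),c_i)$ as a function of $(x_1,c_1),\dots,(x_m,c_m)$, for all $m$ and all real $a_1,\dots,a_m$ (the usual measurability assumption on a class of losses). A set $\mathbb{X}\subseteq\mathcal{X}$ is N-shattered by a class $\mathcal{F}$ of functions if there are $g_1,g_2\in\mathcal{F}$ with $g_1(x)\ne g_2(x)$ for all $x\in\mathbb{X}$ such that for every $T\subseteq\mathbb{X}$ some $g\in\mathcal{F}$ equals $g_1$ on $T$ and $g_2$ on $\mathbb{X}\setminus T$; the Natarajan dimension $d_N(\mathcal{F})$ is the maximal cardinality of an N-shattered set. Assume $d_N(w^*(\mathcal{H}))<\infty$. Write $R_{\mathrm{SPO}}(f):=\mathbb{E}_{(x,c)\sim\mathcal{D}}[\ell_{\mathrm{SPO}}(f(x),c)]$, $\hat R_{\mathrm{SPO}}(f):=\frac1n\sum_{i=1}^n\ell_{\mathrm{SPO}}(f(x_i),c_i)$ and, with i.i.d. uniform signs $\sigma_i\in\{-1,1\}$ independent of the sample, $$\mathfrak{R}^n_{\mathrm{SPO}}(\mathcal{H}):=\mathbb{E}\Bigl[\mathbb{E}_\sigma\Bigl[\sup_{f\in\mathcal{H}}\frac1n\sum_{i=1}^n\sigma_i\,\ell_{\mathrm{SPO}}(f(x_i),c_i)\Bigr]\Bigr].$$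 Then $$\mathfrak{R}^n_{\mathrm{SPO}}(\mathcal{H})\le\omega_S(\mathcal{C})\sqrt{\frac{2\,d_N(w^*(\mathcal{H}))\log(n|\mathfrak{S}|^2)}{n}}.$$ Furthermore, for every $\delta>0$, with probability at least $1-\delta$ over the sample, for all $f\in\mathcal{H}$, $$R_{\mathrm{SPO}}(f)\le\hat R_{\mathrm{SPO}}(f)+2\,\omega_S(\mathcal{C})\sqrt{\frac{2\,d_N(w^*(\mathcal{H}))\log(n|\mathfrak{S}|^2)}{n}}+\omega_S(\mathcal{C})\sqrt{\frac{\log(1/\delta)}{2n}}$$ (for $\delta\ge1$ the claim is void). -/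

import Mathlib

open MeasureTheory

noncomputable section

namespace SPO

/-- The space `ℝ^d` of cost vectors and of decisions. -/
abbrev Vec (d : ℕ) : Type := EuclideanSpace ℝ (Fin d)

variable {d : ℕ} {X : Type*}

/-- A polyhedron: the solution set of finitely many linear inequalities. -/
def IsPolyhedron (S : Set (Vec d)) : Prop :=
  ∃ (m : ℕ) (a : Fin m → Vec d) (b : Fin m → ℝ),
    S = {w | ∀ i, inner ℝ (a i) w ≤ b i}

/-- `w` is an optimization oracle for `S`: for each cost vector `c`, the decision `w c` lies in
`argmin_{v ∈ S} cᵀ v`. -/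
def IsOracle (S : Set (Vec d)) (w : Vec d → Vec d) : Prop :=
  ∀ c, w c ∈ S ∧ ∀ v ∈ S, inner ℝ c (w c) ≤ inner ℝ c v

/-- The SPO loss `cᵀ (w(ĉ) - w(c))` of the prediction `cHat` for the true cost vector `c`. -/
def loss (w : Vec d → Vec d) (cHat c : Vec d) : ℝ :=
  inner ℝ c (w cHat - w c)

/-- The linear optimization gap `max_{v ∈ S} cᵀ v - min_{v ∈ S} cᵀ v`. -/
def gap (S : Set (Vec d)) (c : Vec d) : ℝ :=
  sSup ((fun v => inner ℝ c v) '' S) - sInf ((fun v => inner ℝ c v) '' S)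

/-- The linear optimization gap of a set of cost vectors, `sup_{c ∈ C} gap S c`. -/
def gapSup (S C : Set (Vec d)) : ℝ :=
  sSup (gap S '' C)

/-- The induced decision class `{x ↦ w (f x) : f ∈ H}`. -/
def decisionClass (w : Vec d → Vec d) (H : Set (X → Vec d)) : Set (X → Vec d) :=
  {g | ∃ f ∈ H, g = fun x => w (f x)}

/-- The class `F` N-shatters the set `A`. -/
def NShatters {Y : Type*} (F : Set (X → Y)) (A : Set X) : Prop :=
  ∃ g₁ ∈ F, ∃ g₂ ∈ F, (∀ x ∈ A, g₁ x ≠ g₂ x) ∧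
    ∀ T ⊆ A, ∃ g ∈ F, (∀ x ∈ T, g x = g₁ x) ∧ (∀ x ∈ A \ T, g x = g₂ x)

/-- The Natarajan dimension: the largest cardinality of an N-shattered set
(`⊤` if there are arbitrarily large ones). -/
def natarajanDim {Y : Type*} (F : Set (X → Y)) : ℕ∞ :=
  ⨆ A ∈ {A : Set X | NShatters F A}, A.encard

/-- The empirical SPO risk of `f` on the sample `z`. -/
def empRisk (w : Vec d → Vec d) (f : X → Vec d) {n : ℕ} (z : Fin n → X × Vec d) : ℝ :=
  (1 / (n : ℝ)) * ∑ i, loss w (f (z i).1) (z i).2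

/-- The empirical Rademacher complexity of `H` with respect to the SPO loss on the sample `z`.
The expectation over independent Rademacher signs is the average over all `2 ^ n` sign vectors. -/
def empRademacher (w : Vec d → Vec d) (H : Set (X → Vec d)) {n : ℕ}
    (z : Fin n → X × Vec d) : ℝ :=
  (1 / (2 : ℝ) ^ n) * ∑ σ : Fin n → ℤˣ,
    ⨆ f : H, (1 / (n : ℝ)) * ∑ i, ((σ i : ℤ) : ℝ) * loss w (f.1 (z i).1) (z i).2

variable [MeasurableSpace X]

/-- The SPO risk of `f`: the expected SPO loss under the distribution `D` of `(x, c)`. -/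
def risk (D : Measure (X × Vec d)) (w : Vec d → Vec d) (f : X → Vec d) : ℝ :=
  ∫ z, loss w (f z.1) z.2 ∂D

/-- The law of an i.i.d. sample of size `n` from `D`. -/
def sampleLaw (D : Measure (X × Vec d)) (n : ℕ) : Measure (Fin n → X × Vec d) :=
  Measure.pi fun _ => D

/-- The (expected) Rademacher complexity of `H` with respect to the SPO loss. -/
def rademacher (D : Measure (X × Vec d)) (w : Vec d → Vec d) (H : Set (X → Vec d))
    (n : ℕ) : ℝ :=
  ∫ z, empRademacher w H z ∂(sampleLaw D n)

/-- The usual measurability requirement on a class of losses in empirical process theory: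
up to null sets, every single loss is measurable, and so is, for every sample size and every
choice of weights, the supremum over the class of the weighted sum of losses. It holds whenever
the losses are measurable and the class is countable, or parametrized in a jointly measurable way
by a standard Borel space. Without it the expectations and probabilities may be meaningless. -/
def IsMeasurableClass (D : Measure (X × Vec d)) (w : Vec d → Vec d)
    (H : Set (X → Vec d)) : Prop :=
  (∀ f ∈ H, AEMeasurable (fun z : X × Vec d => loss w (f z.1) z.2) D) ∧
  ∀ (m : ℕ) (a : Fin m → ℝ),
    AEMeasurable (fun z : Fin m → X × Vec d =>
      ⨆ f : H, ∑ i, a i * loss w (f.1 (z i).1) (z i).2) (sampleLaw D m)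

end SPO

end

/-! On a fixed sample, the loss of `f` depends on `f` only through the decisions `w (f xᵢ)`, so the
losses have at most as many restrictions to the sample as the decision class. Natarajan's lemma
(`card_le_of_forall_nShatters`, `ncard_image_comp_le`) bounds that number by N = (n|𝔖|²)^d_N, where
𝔖 is finite because `S` is a polyhedron. Optimality of the oracle puts the losses in [0, ω] with ω =
`gapSup S C`. A vector of losses divided by n therefore has squared norm at most ω²/n, and `massart`
gives the complexity bound √(2 log N · ω²/n), which is the first claim.

The second claim combines this with symmetrization and McDiarmid's inequality
(`exists_uniform_bound`). The delicate point is measurability: suprema of finite weighted sums of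
losses are a.e. measurable by assumption, but the uniform deviation sup_f (R(f) − R̂(f)) need not
be. It is dominated by the mean, over an independent ghost sample, of sup_f (R̂'(f) − R̂(f)). This
mean is a.e. measurable by Tonelli, moves by at most ω/n when one sample point changes, and has
expectation at most twice the Rademacher complexity.

Two devices keep pointwise statements true everywhere. Averages are taken as `lowerMean`, since some
sections of an a.e. measurable function may fail to be measurable while bounded differences must
hold at every point. Losses are set to zero outside a measurable set `K` of full measure on which c
∈ C, so that they are bounded everywhere. -/

noncomputable section

namespace SPO

/-! ### Extreme points of polyhedra -/

/-- A polyhedron has finitely many extreme points: each is determined by its active constraints. -/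
theorem IsPolyhedron.finite_extremePoints {d : ℕ} {S : Set (Vec d)} (hS : IsPolyhedron S) :
    (S.extremePoints ℝ).Finite := by
  obtain ⟨m, a, b, rfl⟩ := hS
  refine Set.Finite.of_finite_image (f := fun w => {i | inner ℝ (a i) w = b i})
    (Set.toFinite _) ?_
  intro v hv u hu hvu
  by_contra hne
  -- If `u` has the same active constraints as `v`, then moving from `v` along ±(v − u) keeps active
  -- constraints tight and, for small steps, inactive ones satisfied. Then `v` is the midpoint of a
  -- segment in the polyhedron. The `+ 1` in the step size avoids division by zero.
  have hslack : ∀ i, ∃ t : ℝ, 0 < t ∧ ∀ r : ℝ, |r| ≤ t →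
      inner ℝ (a i) (v + r • (v - u)) ≤ b i := by
    intro i
    have hvi : inner ℝ (a i) v ≤ b i := hv.1 i
    rcases hvi.lt_or_eq with h | h
    · refine ⟨(b i - inner ℝ (a i) v) / (|inner ℝ (a i) (v - u)| + 1),
        div_pos (by linarith) (by positivity), fun r hr => ?_⟩
      rw [inner_add_right, inner_smul_right]
      have h1 : r * inner ℝ (a i) (v - u) ≤ |r| * (|inner ℝ (a i) (v - u)| + 1) := by
        calc r * inner ℝ (a i) (v - u) ≤ |r * inner ℝ (a i) (v - u)| := le_abs_self _
          _ = |r| * |inner ℝ (a i) (v - u)| := abs_mul _ _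
          _ ≤ _ := by gcongr; linarith
      have h2 := (le_div_iff₀ (by positivity)).1 hr
      linarith
    · have h' : inner ℝ (a i) u = b i := (Set.ext_iff.1 hvu i).1 h
      refine ⟨1, one_pos, fun r _ => ?_⟩
      rw [inner_add_right, inner_smul_right, inner_sub_right, h, h']
      simp
  choose t ht htb using hslack
  obtain ⟨r, hr, hrt⟩ : ∃ r : ℝ, 0 < r ∧ ∀ i, r ≤ t i := by
    rcases isEmpty_or_nonempty (Fin m) with h | h
    · exact ⟨1, one_pos, fun i => h.elim i⟩
    · obtain ⟨j, hj⟩ := Finite.exists_min t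
      exact ⟨t j, ht j, hj⟩
  have hp : v + r • (v - u) ∈ {w | ∀ i, inner ℝ (a i) w ≤ b i} := fun i =>
    htb i r (by rw [abs_of_pos hr]; exact hrt i)
  have hm : v + (-r) • (v - u) ∈ {w | ∀ i, inner ℝ (a i) w ≤ b i} := fun i =>
    htb i (-r) (by rw [abs_neg, abs_of_pos hr]; exact hrt i)
  have hseg : v ∈ openSegment ℝ (v + r • (v - u)) (v + (-r) • (v - u)) := by
    refine ⟨1 / 2, 1 / 2, by norm_num, by norm_num, by norm_num, ?_⟩
    module
  have := hv.2 hp hm hseg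
  have h0 : r • (v - u) = 0 := by simpa using this
  rcases smul_eq_zero.1 h0 with h | h
  · exact hr.ne' h
  · exact hne (sub_eq_zero.1 h)

/-! ### Natarajan's lemma -/

variable {X Y : Type*}

/-- Every member of a class N-shatters the empty set. -/
theorem NShatters.empty {F : Set (X → Y)} {g : X → Y} (hg : g ∈ F) : NShatters F ∅ :=
  ⟨g, hg, g, hg, by simp, fun T _ => ⟨g, hg, by simp, by simp⟩⟩

/-- A set shattered by the tails of a class is shattered by the class. -/
theorem NShatters.of_tail {n : ℕ} {F : Set (Fin (n + 1) → Y)} {B : Set (Fin n)}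
    (h : NShatters (Fin.tail '' F) B) : NShatters F (Fin.succ '' B) := by
  obtain ⟨_, ⟨g₁, hg₁, rfl⟩, _, ⟨g₂, hg₂, rfl⟩, hne, hT⟩ := h
  refine ⟨g₁, hg₁, g₂, hg₂, ?_, fun T hTB => ?_⟩
  · rintro _ ⟨i, hi, rfl⟩
    exact hne i hi
  · obtain ⟨_, ⟨g, hg, rfl⟩, h1, h2⟩ := hT (Fin.succ ⁻¹' T) (by
      intro i hi
      obtain ⟨j, hj, hji⟩ := hTB hi
      rwa [← Fin.succ_injective _ hji])
    refine ⟨g, hg, fun x hx => ?_, ?_⟩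
    · obtain ⟨i, hi, rfl⟩ := hTB hx
      exact h1 i hx
    · rintro _ ⟨⟨i, hi, rfl⟩, hx⟩
      exact h2 i ⟨hi, hx⟩

/-- A set shattered by the common tails of two distinct first values can be enlarged. -/
theorem NShatters.insert_zero {n : ℕ} {F : Set (Fin (n + 1) → Y)} {B : Set (Fin n)} {y y' : Y}
    (hy : y ≠ y')
    (h : NShatters {t : Fin n → Y | (Fin.cons y t : Fin (n + 1) → Y) ∈ F ∧
      (Fin.cons y' t : Fin (n + 1) → Y) ∈ F} B) :
    NShatters F (insert 0 (Fin.succ '' B)) := by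
  obtain ⟨g₁, hg₁, g₂, hg₂, hne, hT⟩ := h
  refine ⟨Fin.cons y g₁, hg₁.1, Fin.cons y' g₂, hg₂.2, ?_, fun T hTB => ?_⟩
  · rintro x (rfl | ⟨i, hi, rfl⟩)
    · simpa using hy
    · simpa using hne i hi
  · obtain ⟨g, hg, h1, h2⟩ := hT (Fin.succ ⁻¹' T) (by
      intro i hi
      rcases hTB hi with h0 | ⟨j, hj, hji⟩
      · exact absurd h0 (Fin.succ_ne_zero i)
      · rwa [← Fin.succ_injective _ hji])
    by_cases h0 : (0 : Fin (n + 1)) ∈ T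
    · refine ⟨Fin.cons y g, hg.1, fun x hx => ?_, ?_⟩
      · rcases hTB hx with rfl | ⟨i, hi, rfl⟩
        · simp
        · simpa using h1 i hx
      · rintro x ⟨rfl | ⟨i, hi, rfl⟩, hx⟩
        · exact absurd h0 hx
        · simpa using h2 i ⟨hi, hx⟩
    · refine ⟨Fin.cons y' g, hg.2, fun x hx => ?_, ?_⟩
      · rcases hTB hx with rfl | ⟨i, hi, rfl⟩
        · exact absurd hx h0
        · simpa using h1 i hx
      · rintro x ⟨rfl | ⟨i, hi, rfl⟩, hx⟩
        · simp
        · simpa using h2 i ⟨hi, hx⟩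

open Classical in
/-- Counting a class of functions on `Fin (n + 1)` by their tails and the pairs of first values. -/
theorem card_le_card_tail_add {n : ℕ} (F : Finset (Fin (n + 1) → Y)) (E : Finset Y)
    (hE : ∀ f ∈ F, f 0 ∈ E) :
    F.card ≤ (F.image Fin.tail).card + ∑ p ∈ E.offDiag,
      ((F.image Fin.tail).filter fun t => (Fin.cons p.1 t : Fin (n + 1) → Y) ∈ F ∧
        (Fin.cons p.2 t : Fin (n + 1) → Y) ∈ F).card := by
  have hfib : ∀ t ∈ F.image Fin.tail, (F.filter fun f => Fin.tail f = t).card ≤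
      1 + ∑ p ∈ E.offDiag, if (Fin.cons p.1 t : Fin (n + 1) → Y) ∈ F ∧
        (Fin.cons p.2 t : Fin (n + 1) → Y) ∈ F then 1 else 0 := by
    intro t _
    -- `V` is the set of first values that extend the tail `t`. Since |V| ≤ 1 + |V|(|V| − 1), the
    -- surplus over one extension is paid for by ordered pairs of distinct first values.
    set V : Finset Y := E.filter fun y => (Fin.cons y t : Fin (n + 1) → Y) ∈ F with hV
    have h1 : (F.filter fun f => Fin.tail f = t).card ≤ V.card := by
      refine Finset.card_le_card_of_injOn (fun f => f 0) ?_ ?_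
      · intro f hf
        obtain ⟨hfF, rfl⟩ := Finset.mem_filter.1 hf
        exact Finset.mem_filter.2 ⟨hE f hfF, by rwa [Fin.cons_self_tail]⟩
      · intro f hf g hg hfg
        have hft := (Finset.mem_filter.1 hf).2
        have hgt := (Finset.mem_filter.1 hg).2
        rw [← Fin.cons_self_tail f, ← Fin.cons_self_tail g, hft, hgt]
        exact congrArg (fun y => (Fin.cons y t : Fin (n + 1) → Y)) hfg
    have h2 : V.offDiag.card ≤ ∑ p ∈ E.offDiag, if (Fin.cons p.1 t : Fin (n + 1) → Y) ∈ F ∧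
        (Fin.cons p.2 t : Fin (n + 1) → Y) ∈ F then 1 else 0 := by
      rw [← Finset.card_filter]
      refine Finset.card_le_card fun p hp => ?_
      obtain ⟨hp1, hp2, hp3⟩ := Finset.mem_offDiag.1 hp
      obtain ⟨h1E, h1F⟩ := Finset.mem_filter.1 hp1
      obtain ⟨h2E, h2F⟩ := Finset.mem_filter.1 hp2
      exact Finset.mem_filter.2 ⟨Finset.mem_offDiag.2 ⟨h1E, h2E, hp3⟩, h1F, h2F⟩
    have h3 : V.card ≤ 1 + V.offDiag.card := by
      rw [Finset.offDiag_card]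
      rcases V.card with _ | k
      · simp
      · have : (k + 1) * (k + 1) - (k + 1) = (k + 1) * k := by
          rw [Nat.mul_succ, Nat.add_sub_cancel]
        rw [this]
        nlinarith
    omega
  calc F.card = ∑ t ∈ F.image Fin.tail, (F.filter fun f => Fin.tail f = t).card :=
        Finset.card_eq_sum_card_image Fin.tail F
    _ ≤ ∑ t ∈ F.image Fin.tail, (1 + ∑ p ∈ E.offDiag,
          if (Fin.cons p.1 t : Fin (n + 1) → Y) ∈ F ∧
            (Fin.cons p.2 t : Fin (n + 1) → Y) ∈ F then 1 else 0) := Finset.sum_le_sum hfib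
    _ = _ := by
        rw [Finset.sum_add_distrib, Finset.sum_comm, Finset.card_eq_sum_ones]
        simp only [Finset.card_filter]

/-- **Natarajan's lemma** for a class of functions on `Fin n` with values in the finite set `E`. -/
theorem card_le_of_forall_nShatters (E : Finset Y) (n k : ℕ) (F : Finset (Fin n → Y))
    (hE : ∀ f ∈ F, ∀ i, f i ∈ E)
    (hk : ∀ B : Set (Fin n), NShatters (F : Set (Fin n → Y)) B → B.ncard ≤ k) :
    F.card ≤ (1 + n * E.offDiag.card) ^ k := by
  classical
  induction n generalizing k with
  | zero =>
    calc F.card ≤ 1 := Finset.card_le_one.2 fun f _ g _ => Subsingleton.elim f g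
      _ ≤ _ := Nat.one_le_pow _ _ (by omega)
  | succ n ih =>
    have hcount := card_le_card_tail_add F E fun f hf => hE f hf 0
    have hEtail : ∀ t ∈ F.image Fin.tail, ∀ i, t i ∈ E := by
      intro t ht i
      obtain ⟨f, hf, rfl⟩ := Finset.mem_image.1 ht
      exact hE f hf i.succ
    have htail : (F.image Fin.tail).card ≤ (1 + n * E.offDiag.card) ^ k := by
      refine ih k _ hEtail fun B hB => ?_
      rw [Finset.coe_image] at hB
      rw [← Set.ncard_image_of_injective B (Fin.succ_injective n)]
      exact hk _ hB.of_tail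
    have hpair : ∀ p ∈ E.offDiag, ∀ B : Set (Fin n),
        NShatters (((F.image Fin.tail).filter fun t => (Fin.cons p.1 t : Fin (n + 1) → Y) ∈ F ∧
          (Fin.cons p.2 t : Fin (n + 1) → Y) ∈ F : Finset (Fin n → Y)) : Set (Fin n → Y)) B →
        B.ncard + 1 ≤ k := by
      intro p hp B hB
      have hset : (((F.image Fin.tail).filter fun t => (Fin.cons p.1 t : Fin (n + 1) → Y) ∈ F ∧
          (Fin.cons p.2 t : Fin (n + 1) → Y) ∈ F : Finset (Fin n → Y)) : Set (Fin n → Y)) =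
          {t | (Fin.cons p.1 t : Fin (n + 1) → Y) ∈ (F : Set (Fin (n + 1) → Y)) ∧
            (Fin.cons p.2 t : Fin (n + 1) → Y) ∈ (F : Set (Fin (n + 1) → Y))} := by
        ext t
        simp only [Finset.coe_filter, Finset.mem_image, Set.mem_ofPred_eq, Finset.mem_coe,
          and_iff_right_iff_imp]
        exact fun h => ⟨_, h.1, Fin.tail_cons _ _⟩
      rw [hset] at hB
      have h1 := hk _ (hB.insert_zero (Finset.mem_offDiag.1 hp).2.2)
      rwa [Set.ncard_insert_of_notMem (by simp [Fin.succ_ne_zero]) (Set.toFinite _),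
        Set.ncard_image_of_injective B (Fin.succ_injective n)] at h1
    -- Tails common to two distinct first values shatter one point less. For k = 0 there are none: a
    -- single one would shatter ∅, hence make {0} shattered by `F`. For k + 1 the induction
    -- hypothesis applies to them with k.
    rcases k with _ | k
    · have hz : ∀ p ∈ E.offDiag, ((F.image Fin.tail).filter fun t =>
          (Fin.cons p.1 t : Fin (n + 1) → Y) ∈ F ∧
          (Fin.cons p.2 t : Fin (n + 1) → Y) ∈ F).card = 0 := by
        intro p hp
        by_contra h0
        obtain ⟨t, ht⟩ := Finset.card_ne_zero.1 h0
        have := hpair p hp ∅ (NShatters.empty (Finset.mem_coe.2 ht))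
        omega
      rw [Finset.sum_eq_zero hz] at hcount
      simpa using hcount.trans (by simpa using htail)
    · have hp : ∀ p ∈ E.offDiag, ((F.image Fin.tail).filter fun t =>
          (Fin.cons p.1 t : Fin (n + 1) → Y) ∈ F ∧
          (Fin.cons p.2 t : Fin (n + 1) → Y) ∈ F).card ≤ (1 + n * E.offDiag.card) ^ k := by
        intro p hp
        refine ih k _ (fun t ht => hEtail t (Finset.mem_filter.1 ht).1) fun B hB => ?_
        have := hpair p hp B hB
        omega
      calc F.card ≤ (1 + n * E.offDiag.card) ^ (k + 1) +
            ∑ _p ∈ E.offDiag, (1 + n * E.offDiag.card) ^ k :=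
            hcount.trans (add_le_add htail (Finset.sum_le_sum hp))
        _ = (1 + n * E.offDiag.card) ^ k * (1 + (n + 1) * E.offDiag.card) := by
            rw [Finset.sum_const, smul_eq_mul]; ring
        _ ≤ (1 + (n + 1) * E.offDiag.card) ^ k * (1 + (n + 1) * E.offDiag.card) := by
            gcongr; omega
        _ = _ := (pow_succ _ _).symm

/-- A set of indices shattered by the restriction of a class to a sample gives a shattered set of
the same size. -/
theorem NShatters.image_comp {n : ℕ} {F : Set (X → Y)} {x : Fin n → X} {B : Set (Fin n)}
    (h : NShatters ((fun g : X → Y => g ∘ x) '' F) B) :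
    Set.InjOn x B ∧ NShatters F (x '' B) := by
  obtain ⟨_, ⟨g₁, hg₁, rfl⟩, _, ⟨g₂, hg₂, rfl⟩, hne, hT⟩ := h
  refine ⟨fun i hi j hj hij => ?_, g₁, hg₁, g₂, hg₂, ?_, fun T _ => ?_⟩
  -- If x i = x j with i ≠ j, the member equal to g₁ at i and to g₂ at j forces g₁ (x i) = g₂ (x i).
  · by_contra hne'
    obtain ⟨_, ⟨g, hg, rfl⟩, h1, h2⟩ := hT {i} (by simpa using hi)
    have e1 : g (x i) = g₁ (x i) := h1 i rfl
    have e2 : g (x j) = g₂ (x j) := h2 j ⟨hj, fun h => hne' h.symm⟩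
    refine hne i hi ?_
    change g₁ (x i) = g₂ (x i)
    rw [← e1, hij, e2]
  · rintro _ ⟨i, hi, rfl⟩
    exact hne i hi
  · obtain ⟨_, ⟨g, hg, rfl⟩, h1, h2⟩ := hT (x ⁻¹' T ∩ B) Set.inter_subset_right
    refine ⟨g, hg, fun y hy => ?_, ?_⟩
    · obtain ⟨i, hi, rfl⟩ := (‹T ⊆ x '' B› hy)
      exact h1 i ⟨hy, hi⟩
    · rintro _ ⟨⟨i, hi, rfl⟩, hx⟩
      exact h2 i ⟨hi, fun h => hx h.1⟩

/-- **Natarajan's lemma**: a class with values in the finite set `E` has at most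
`(n |E|²) ^ d_N` restrictions to a sample of size `n`. -/
theorem ncard_image_comp_le {F : Set (X → Y)} {E : Set Y} (hEfin : E.Finite)
    (hE : ∀ g ∈ F, ∀ x, g x ∈ E) (hEne : E.Nonempty) (hdim : natarajanDim F ≠ ⊤)
    {n : ℕ} (hn : 1 ≤ n) (x : Fin n → X) :
    ((fun g : X → Y => g ∘ x) '' F).Finite ∧
    ((fun g : X → Y => g ∘ x) '' F).ncard ≤ (n * E.ncard ^ 2) ^ (natarajanDim F).toNat := by
  classical
  have hfin : ((fun g : X → Y => g ∘ x) '' F).Finite := by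
    refine (Set.Finite.pi' fun _ : Fin n => hEfin).subset ?_
    rintro _ ⟨g, hg, rfl⟩ i
    exact hE g hg _
  refine ⟨hfin, ?_⟩
  have h := card_le_of_forall_nShatters hEfin.toFinset n (natarajanDim F).toNat hfin.toFinset
    (by
      intro f hf i
      obtain ⟨g, hg, rfl⟩ := hfin.mem_toFinset.1 hf
      exact hEfin.mem_toFinset.2 (hE g hg _))
    (by
      intro B hB
      rw [hfin.coe_toFinset] at hB
      obtain ⟨hinj, hsh⟩ := hB.image_comp
      rw [← hinj.ncard_image]
      have hle : (x '' B).encard ≤ natarajanDim F :=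
        le_iSup₂ (f := fun (A : Set X) (_ : A ∈ {A : Set X | NShatters F A}) => A.encard) _ hsh
      exact ENat.toNat_le_toNat hle hdim)
  rw [Set.ncard_eq_toFinset_card _ hfin, Set.ncard_eq_toFinset_card _ hEfin]
  refine h.trans (Nat.pow_le_pow_left ?_ _)
  have hpos : 1 ≤ hEfin.toFinset.card :=
    Finset.card_pos.2 (by simpa using hEne)
  rw [Finset.offDiag_card]
  obtain ⟨k, hk⟩ := Nat.exists_eq_add_of_le hpos
  rw [hk]
  have : (1 + k) * (1 + k) - (1 + k) = (1 + k) * k := by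
    rw [Nat.mul_add, Nat.mul_one, Nat.add_sub_cancel_left]
  rw [this]
  -- The claim is 1 + n(|E|² − |E|) ≤ n|E|², that is, 1 ≤ n|E|.
  nlinarith [mul_le_mul hn hpos zero_le_one (Nat.zero_le n), Nat.zero_le (n * k)]

/-! ### Massart's finite class lemma -/

/-- The moment generating function of a Rademacher sum. -/
theorem sum_exp_rademacher_le {n : ℕ} (v : Fin n → ℝ) :
    ∑ σ : Fin n → ℤˣ, Real.exp (∑ i, ((σ i : ℤ) : ℝ) * v i) ≤
      2 ^ n * Real.exp ((∑ i, v i ^ 2) / 2) := by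
  have h1 : ∑ σ : Fin n → ℤˣ, Real.exp (∑ i, ((σ i : ℤ) : ℝ) * v i) =
      ∏ i, ∑ u : ℤˣ, Real.exp (((u : ℤ) : ℝ) * v i) := by
    rw [Finset.prod_univ_sum, Fintype.piFinset_univ]
    exact Finset.sum_congr rfl fun σ _ => Real.exp_sum _ _
  have h2 : ∀ i, ∑ u : ℤˣ, Real.exp (((u : ℤ) : ℝ) * v i) = 2 * Real.cosh (v i) := by
    intro i
    rw [Real.cosh_eq]
    simp
    ring
  rw [h1, Finset.prod_congr rfl fun i _ => h2 i, Finset.prod_mul_distrib]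
  simp only [Finset.prod_const, Finset.card_univ, Fintype.card_fin]
  rw [Finset.sum_div, Real.exp_sum]
  gcongr with i
  exact Real.cosh_le_exp_half_sq _

/-- Optimizing a bound of the form `L / s + s B / 2` over `s > 0`. -/
theorem le_sqrt_of_forall_le_div_add_mul {a L B : ℝ} (hL : 0 ≤ L) (hB : 0 ≤ B)
    (h : ∀ s : ℝ, 0 < s → s * a ≤ L + s ^ 2 * B / 2) : a ≤ √(2 * L * B) := by
  by_contra! hlt
  have ha : 0 < a := (Real.sqrt_nonneg _).trans_lt hlt
  have hsq : 2 * L * B < a ^ 2 := (Real.sqrt_lt' ha).1 hlt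
  -- For B = 0 the choice s = (L + 1)/a gives L + 1 ≤ L; for B > 0 the optimal s = a/B gives a² ≤
  -- 2LB.
  rcases hB.eq_or_lt with rfl | hB
  · have h1 := h ((L + 1) / a) (by positivity)
    rw [div_mul_cancel₀ _ ha.ne'] at h1
    linarith
  · have h1 := h (a / B) (by positivity)
    have h2 : (a / B) ^ 2 * B / 2 = a ^ 2 / (2 * B) := by field_simp
    have h3 : a / B * a = 2 * (a ^ 2 / (2 * B)) := by field_simp
    have h4 : a ^ 2 / (2 * B) ≤ L := by linarith
    rw [div_le_iff₀ (by positivity)] at h4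
    nlinarith

/-- **Massart's finite class lemma** for a family of vectors with finitely many members. -/
theorem massart {ι : Type*} [Nonempty ι] {n : ℕ} (v : ι → Fin n → ℝ) (hfin : (Set.range v).Finite)
    {N B : ℝ} (hN : ((Set.range v).ncard : ℝ) ≤ N) (hB : ∀ f, ∑ i, v f i ^ 2 ≤ B) :
    (1 / (2 : ℝ) ^ n) * ∑ σ : Fin n → ℤˣ, ⨆ f, ∑ i, ((σ i : ℤ) : ℝ) * v f i ≤
      √(2 * Real.log N * B) := by
  classical
  obtain ⟨f₀⟩ := ‹Nonempty ι›
  have hB0 : 0 ≤ B := (Finset.sum_nonneg fun i _ => sq_nonneg _).trans (hB f₀)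
  have hcard : 1 ≤ (Set.range v).ncard :=
    (Set.ncard_pos hfin).2 ⟨_, f₀, rfl⟩
  have hN1 : 1 ≤ N := le_trans (by exact_mod_cast hcard) hN
  refine le_sqrt_of_forall_le_div_add_mul (Real.log_nonneg hN1) hB0 fun s hs => ?_
  set M : (Fin n → ℤˣ) → ℝ := fun σ => ⨆ f, ∑ i, ((σ i : ℤ) : ℝ) * v f i
  -- The exponential of a maximum is at most the sum of the exponentials over the distinct vectors;
  -- only the size of the range enters, not that of `ι`.
  have hM : ∀ σ, Real.exp (s * M σ) ≤
      ∑ u ∈ hfin.toFinset, Real.exp (∑ i, ((σ i : ℤ) : ℝ) * (s * u i)) := by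
    intro σ
    have hpos : 0 < ∑ u ∈ hfin.toFinset, Real.exp (∑ i, ((σ i : ℤ) : ℝ) * (s * u i)) :=
      Finset.sum_pos (fun _ _ => Real.exp_pos _) ⟨v f₀, by simp⟩
    rw [← Real.le_log_iff_exp_le hpos, ← le_div_iff₀' hs]
    have : Nonempty ι := ⟨f₀⟩
    refine ciSup_le fun f => ?_
    rw [le_div_iff₀' hs, Real.le_log_iff_exp_le hpos, Finset.mul_sum]
    refine le_trans (le_of_eq ?_) (Finset.single_le_sum
      (f := fun u : Fin n → ℝ => Real.exp (∑ i, ((σ i : ℤ) : ℝ) * (s * u i)))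
      (fun _ _ => (Real.exp_pos _).le) (hfin.mem_toFinset.2 ⟨f, rfl⟩))
    congr 1
    exact Finset.sum_congr rfl fun i _ => by ring
  have hsum : ∑ σ, Real.exp (s * M σ) ≤ 2 ^ n * (N * Real.exp (s ^ 2 * B / 2)) := by
    calc ∑ σ, Real.exp (s * M σ)
        ≤ ∑ σ : Fin n → ℤˣ, ∑ u ∈ hfin.toFinset,
            Real.exp (∑ i, ((σ i : ℤ) : ℝ) * (s * u i)) := Finset.sum_le_sum fun σ _ => hM σ
      _ = ∑ u ∈ hfin.toFinset, ∑ σ : Fin n → ℤˣ,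
            Real.exp (∑ i, ((σ i : ℤ) : ℝ) * (s * u i)) := Finset.sum_comm
      _ ≤ ∑ u ∈ hfin.toFinset, 2 ^ n * Real.exp (s ^ 2 * B / 2) := by
          refine Finset.sum_le_sum fun u hu => ?_
          obtain ⟨f, rfl⟩ := hfin.mem_toFinset.1 hu
          refine (sum_exp_rademacher_le _).trans ?_
          gcongr
          simp only [mul_pow]
          rw [← Finset.mul_sum]
          exact mul_le_mul_of_nonneg_left (hB f) (sq_nonneg s)
      _ = ((Set.range v).ncard : ℝ) * (2 ^ n * Real.exp (s ^ 2 * B / 2)) := by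
          rw [Finset.sum_const, nsmul_eq_mul, Set.ncard_eq_toFinset_card _ hfin]
      _ ≤ N * (2 ^ n * Real.exp (s ^ 2 * B / 2)) := by gcongr
      _ = _ := by ring
  have hjensen : Real.exp (∑ σ : Fin n → ℤˣ, (1 / (2 : ℝ) ^ n) • (s * M σ)) ≤
      ∑ σ : Fin n → ℤˣ, (1 / (2 : ℝ) ^ n) • Real.exp (s * M σ) := by
    refine convexOn_exp.map_sum_le (fun _ _ => by positivity) ?_ (fun _ _ => Set.mem_univ _)
    rw [Finset.sum_const, Finset.card_univ]
    simp
  rw [← Real.log_exp (s ^ 2 * B / 2), ← Real.log_mul (by linarith) (Real.exp_pos _).ne',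
    Real.le_log_iff_exp_le (by positivity)]
  have he : s * (1 / (2 : ℝ) ^ n * ∑ σ, M σ) =
      ∑ σ : Fin n → ℤˣ, (1 / (2 : ℝ) ^ n) • (s * M σ) := by
    simp only [smul_eq_mul, Finset.mul_sum]
    exact Finset.sum_congr rfl fun σ _ => by ring
  rw [he]
  refine hjensen.trans ?_
  rw [← Finset.smul_sum, smul_eq_mul, one_div, inv_mul_le_iff₀ (by positivity)]
  exact hsum

/-! ### Lower means and Hoeffding's lemma -/

section LowerMean

variable {α β : Type*} [MeasurableSpace α] [MeasurableSpace β]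

/-- The mean of a nonnegative function, as a lower integral: monotone and compatible with adding
constants even for functions that are not measurable. -/
def lowerMean (μ : Measure α) (f : α → ℝ) : ℝ :=
  (∫⁻ x, ENNReal.ofReal (f x) ∂μ).toReal

variable {μ : Measure α} {ν : Measure β}

theorem lowerMean_nonneg (f : α → ℝ) : 0 ≤ lowerMean μ f := ENNReal.toReal_nonneg

theorem lowerMean_eq_integral {f : α → ℝ} (hf : ∀ x, 0 ≤ f x) (hm : AEMeasurable f μ) :
    lowerMean μ f = ∫ x, f x ∂μ :=
  (integral_eq_lintegral_of_nonneg_ae (Filter.Eventually.of_forall hf)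
    hm.aestronglyMeasurable).symm

variable [IsProbabilityMeasure μ]

theorem aemeasurable_lowerMean {f : β × α → ℝ} (hm : AEMeasurable f (ν.prod μ)) :
    AEMeasurable (fun r => lowerMean μ fun x => f (r, x)) ν :=
  hm.ennreal_ofReal.lintegral_prod_right'.ennreal_toReal

/-- The sections in the exceptional null set may be non-measurable; they are the reason for working
with `lowerMean`. -/
theorem ae_aemeasurable_right {f : β × α → ℝ} (hm : AEMeasurable f (ν.prod μ)) :
    ∀ᵐ r ∂ν, AEMeasurable (fun x => f (r, x)) μ :=
  (hm.aestronglyMeasurable.prodMk_left).mono fun _ h => h.aemeasurable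

theorem lintegral_ofReal_le_of_le {f : α → ℝ} {b : ℝ} (hf : ∀ x, f x ≤ b) :
    ∫⁻ x, ENNReal.ofReal (f x) ∂μ ≤ ENNReal.ofReal b :=
  (lintegral_mono fun x => ENNReal.ofReal_le_ofReal (hf x)).trans (by simp)

theorem lowerMean_le {f : α → ℝ} {b : ℝ} (hb : 0 ≤ b) (hf : ∀ x, f x ≤ b) :
    lowerMean μ f ≤ b :=
  ENNReal.toReal_le_of_le_ofReal hb (lintegral_ofReal_le_of_le hf)

/-- Lower integrals are monotone and additive against a measurable summand, here a constant, so
bounded differences survive averaging without any measurability. The bound on `g` keeps `toReal`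
away from ⊤. -/
theorem lowerMean_le_add {f g : α → ℝ} {b c : ℝ} (hg : ∀ x, 0 ≤ g x) (hgb : ∀ x, g x ≤ b)
    (hc : 0 ≤ c) (h : ∀ x, f x ≤ g x + c) : lowerMean μ f ≤ lowerMean μ g + c := by
  have hfin : ∫⁻ x, ENNReal.ofReal (g x) ∂μ ≠ ⊤ :=
    ((lintegral_ofReal_le_of_le hgb).trans_lt ENNReal.ofReal_lt_top).ne
  have h1 : ∫⁻ x, ENNReal.ofReal (f x) ∂μ ≤
      ∫⁻ x, ENNReal.ofReal (g x) ∂μ + ENNReal.ofReal c := by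
    calc ∫⁻ x, ENNReal.ofReal (f x) ∂μ
        ≤ ∫⁻ x, (ENNReal.ofReal (g x) + ENNReal.ofReal c) ∂μ := lintegral_mono fun x => by
          rw [← ENNReal.ofReal_add (hg x) hc]
          exact ENNReal.ofReal_le_ofReal (h x)
      _ = _ := by rw [lintegral_add_right _ measurable_const]; simp
  have h2 := ENNReal.toReal_mono (ENNReal.add_ne_top.2 ⟨hfin, ENNReal.ofReal_ne_top⟩) h1
  rwa [ENNReal.toReal_add hfin ENNReal.ofReal_ne_top, ENNReal.toReal_ofReal hc] at h2

variable [IsProbabilityMeasure ν]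

theorem integral_lowerMean {f : β × α → ℝ} {b : ℝ} (hm : AEMeasurable f (ν.prod μ))
    (h0 : ∀ p, 0 ≤ f p) (hb : ∀ p, f p ≤ b) :
    ∫ r, lowerMean μ (fun x => f (r, x)) ∂ν = ∫ p, f p ∂(ν.prod μ) := by
  rw [integral_prod _ (Integrable.of_mem_Icc 0 b hm (.of_forall fun p => ⟨h0 p, hb p⟩))]
  refine integral_congr_ae ?_
  filter_upwards [ae_aemeasurable_right hm] with r hr
  exact lowerMean_eq_integral (fun x => h0 _) hr

theorem integrable_exp_mul_of_mem_Icc {f : α → ℝ} {a b : ℝ} (hm : AEMeasurable f μ)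
    (hf : ∀ x, f x ∈ Set.Icc a b) (s : ℝ) : Integrable (fun x => Real.exp (s * f x)) μ := by
  refine Integrable.of_mem_Icc 0 (Real.exp (|s| * max |a| |b|))
    (Real.measurable_exp.comp_aemeasurable (hm.const_mul s)) (.of_forall fun x =>
      ⟨(Real.exp_pos _).le, Real.exp_le_exp.2 ?_⟩)
  calc s * f x ≤ |s * f x| := le_abs_self _
    _ = |s| * |f x| := abs_mul _ _
    _ ≤ _ := by gcongr; exact abs_le_max_abs_abs (hf x).1 (hf x).2

/-- **Hoeffding's lemma** for a function that oscillates by at most `c`. -/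
theorem integral_exp_mul_le_of_osc {f : α → ℝ} {c : ℝ} (hm : AEMeasurable f μ)
    (h0 : ∀ x, 0 ≤ f x) (hc : ∀ x y, f x ≤ f y + c) (s : ℝ) :
    ∫ x, Real.exp (s * f x) ∂μ ≤ Real.exp (s ^ 2 * c ^ 2 / 8) * Real.exp (s * ∫ x, f x ∂μ) := by
  have hne : Nonempty α := nonempty_of_isProbabilityMeasure μ
  have hbdd : BddBelow (Set.range f) := ⟨0, by rintro _ ⟨x, rfl⟩; exact h0 x⟩
  -- Oscillation at most `c` places the values in the interval of length `c` starting at the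
  -- infimum.
  have hsg := ProbabilityTheory.hasSubgaussianMGF_of_mem_Icc (μ := μ) (a := ⨅ y, f y)
    (b := (⨅ y, f y) + c) hm (.of_forall fun x => ⟨ciInf_le hbdd x, by
      have : f x - c ≤ ⨅ y, f y := le_ciInf fun y => by linarith [hc x y]
      linarith⟩)
  have h := hsg.mgf_le s
  have hval : ((‖(⨅ y, f y) + c - ⨅ y, f y‖₊ / 2 : NNReal) ^ 2 : NNReal) * s ^ 2 / 2 =
      s ^ 2 * c ^ 2 / 8 := by
    push_cast
    rw [add_sub_cancel_left, Real.norm_eq_abs, div_pow, sq_abs]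
    ring
  rw [hval] at h
  have hs : ∫ x, Real.exp (s * f x) ∂μ =
      ProbabilityTheory.mgf (fun x => f x - ∫ x, f x ∂μ) μ s * Real.exp (s * ∫ x, f x ∂μ) := by
    rw [ProbabilityTheory.mgf, ← integral_mul_const]
    refine integral_congr_ae (.of_forall fun x => ?_)
    change Real.exp _ = Real.exp _ * Real.exp _
    rw [← Real.exp_add]
    ring_nf
  rw [hs]
  exact mul_le_mul_of_nonneg_right h (Real.exp_pos _).le

/-- Integrating out one coordinate in an exponential moment. -/
theorem integral_exp_mul_prod_le {f : β × α → ℝ} {b c : ℝ} (hm : AEMeasurable f (ν.prod μ))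
    (h0 : ∀ p, 0 ≤ f p) (hb : ∀ p, f p ≤ b) (hc : ∀ r x y, f (r, x) ≤ f (r, y) + c) (s : ℝ) :
    ∫ p, Real.exp (s * f p) ∂(ν.prod μ) ≤
      Real.exp (s ^ 2 * c ^ 2 / 8) *
        ∫ r, Real.exp (s * lowerMean μ fun x => f (r, x)) ∂ν := by
  have hint := integrable_exp_mul_of_mem_Icc hm (fun p => ⟨h0 p, hb p⟩) s
  have hb0 : 0 ≤ b := by
    have : Nonempty (β × α) := nonempty_of_isProbabilityMeasure (ν.prod μ)
    obtain ⟨p⟩ := this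
    exact (h0 p).trans (hb p)
  have hint' := integrable_exp_mul_of_mem_Icc (aemeasurable_lowerMean hm)
    (fun r => ⟨lowerMean_nonneg _, lowerMean_le hb0 fun x => hb (r, x)⟩) s
  rw [integral_prod _ hint, ← integral_const_mul]
  refine integral_mono_ae hint.integral_prod_left (hint'.const_mul _) ?_
  filter_upwards [ae_aemeasurable_right hm] with r hr
  change ∫ x, Real.exp (s * f (r, x)) ∂μ ≤ _ * Real.exp (s * lowerMean μ fun x => f (r, x))
  rw [lowerMean_eq_integral (fun x => h0 _) hr]
  exact integral_exp_mul_le_of_osc hr (fun x => h0 _) (hc r) s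

end LowerMean

/-! ### McDiarmid's inequality -/

section McDiarmid

variable {Z : Type*} [MeasurableSpace Z] (D : Measure Z) [IsProbabilityMeasure D]

/-- Splitting off the first of `n + 1` independent copies. -/
theorem measurePreserving_cons (n : ℕ) :
    MeasurePreserving (fun p : (Fin n → Z) × Z => (Fin.cons p.2 p.1 : Fin (n + 1) → Z))
      ((Measure.pi fun _ : Fin n => D).prod D) (Measure.pi fun _ : Fin (n + 1) => D) := by
  have h1 := (measurePreserving_piFinSuccAbove (α := fun _ : Fin (n + 1) => Z)
    (fun _ => D) 0).symm
  have h2 := h1.comp (Measure.measurePreserving_swap (μ := Measure.pi fun _ : Fin n => D) (ν := D))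
  convert! h2 using 1
  ext p : 1
  simp [MeasurableEquiv.piFinSuccAbove, Fin.insertNthEquiv]

/-- The exponential moments of a function with bounded differences of independent variables. -/
theorem integral_exp_mul_le_of_bounded_differences (n : ℕ) (g : (Fin n → Z) → ℝ) {b c : ℝ}
    (hm : AEMeasurable g (Measure.pi fun _ => D)) (h0 : ∀ z, 0 ≤ g z) (hb : ∀ z, g z ≤ b)
    (hc : ∀ z i y, g (Function.update z i y) ≤ g z + c) (s : ℝ) :
    ∫ z, Real.exp (s * g z) ∂(Measure.pi fun _ => D) ≤
      Real.exp (n * (s ^ 2 * c ^ 2 / 8)) *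
        Real.exp (s * ∫ z, g z ∂(Measure.pi fun _ => D)) := by
  induction n with
  | zero =>
    have hg : ∀ z, g z = g (fun i => i.elim0) := fun z => congrArg g (Subsingleton.elim _ _)
    simp_rw [hg]
    simp
  | succ n ih =>
    have hmp := measurePreserving_cons D n
    set f : (Fin n → Z) × Z → ℝ := fun p => g (Fin.cons p.2 p.1) with hf
    have hfm : AEMeasurable f ((Measure.pi fun _ : Fin n => D).prod D) := by
      refine AEMeasurable.comp_aemeasurable (g := g) ?_ hmp.aemeasurable
      rwa [hmp.map_eq]
    have hc0 : 0 ≤ c := by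
      have : Nonempty Z := nonempty_of_isProbabilityMeasure D
      have h := hc (fun _ => Classical.arbitrary Z) 0 (Classical.arbitrary Z)
      rw [Function.update_eq_self_iff.2 rfl] at h
      linarith
    have hb0 : 0 ≤ b := by
      have : Nonempty Z := nonempty_of_isProbabilityMeasure D
      exact (h0 fun _ => Classical.arbitrary Z).trans (hb _)
    have hg1 : ∫ z, Real.exp (s * g z) ∂(Measure.pi fun _ => D) =
        ∫ p, Real.exp (s * f p) ∂((Measure.pi fun _ : Fin n => D).prod D) := by
      rw [← hmp.map_eq, integral_map hmp.aemeasurable]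
      rw [hmp.map_eq]
      exact (Real.measurable_exp.comp_aemeasurable (hm.const_mul s)).aestronglyMeasurable
    have hg2 : ∫ z, g z ∂(Measure.pi fun _ => D) =
        ∫ p, f p ∂((Measure.pi fun _ : Fin n => D).prod D) := by
      rw [← hmp.map_eq, integral_map hmp.aemeasurable]
      rw [hmp.map_eq]
      exact hm.aestronglyMeasurable
    have h1 := integral_exp_mul_prod_le hfm (fun p => h0 _) (fun p => hb _) (c := c)
      (fun r x y => by
        have h := hc (Fin.cons y r) 0 x
        rwa [Fin.update_cons_zero] at h) s
    -- After the first coordinate is averaged out, the function of the others still has differences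
    -- at most `c` at every point.
    have h2 := ih (fun r => lowerMean D fun x => f (r, x)) (aemeasurable_lowerMean hfm)
      (fun r => lowerMean_nonneg _) (fun r => lowerMean_le hb0 fun x => hb _)
      (fun r i y => lowerMean_le_add (fun x => h0 _) (fun x => hb _) hc0 fun x => by
        have h := hc (Fin.cons x r) i.succ y
        rwa [← Fin.cons_update] at h)
    rw [integral_lowerMean hfm (fun p => h0 _) (fun p => hb _)] at h2
    rw [hg1, hg2]
    refine h1.trans ((mul_le_mul_of_nonneg_left h2 (Real.exp_pos _).le).trans (le_of_eq ?_))
    rw [← mul_assoc, ← Real.exp_add]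
    push_cast
    ring_nf

/-- **McDiarmid's inequality**. -/
theorem mcdiarmid {n : ℕ} (hn : 1 ≤ n) (g : (Fin n → Z) → ℝ) {b c : ℝ}
    (hm : AEMeasurable g (Measure.pi fun _ => D)) (h0 : ∀ z, 0 ≤ g z) (hb : ∀ z, g z ≤ b)
    (hc0 : 0 < c) (hc : ∀ z i y, g (Function.update z i y) ≤ g z + c) {t : ℝ} (ht : 0 ≤ t) :
    (Measure.pi fun _ => D).real {z | (∫ z, g z ∂(Measure.pi fun _ => D)) + t ≤ g z} ≤
      Real.exp (-2 * t ^ 2 / (n * c ^ 2)) := by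
  have hn0 : (0 : ℝ) < n := by exact_mod_cast hn
  -- This `s` minimizes the Chernoff exponent −s t + n s² c²/8.
  set s : ℝ := 4 * t / (n * c ^ 2) with hs
  have h1 := ProbabilityTheory.measure_ge_le_exp_mul_mgf (μ := Measure.pi fun _ : Fin n => D)
    (X := g) (t := s) ((∫ z, g z ∂(Measure.pi fun _ => D)) + t) (by positivity)
    (integrable_exp_mul_of_mem_Icc hm (fun z => ⟨h0 z, hb z⟩) s)
  refine h1.trans ((mul_le_mul_of_nonneg_left
    (integral_exp_mul_le_of_bounded_differences D n g hm h0 hb hc s) (Real.exp_pos _).le).trans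
      (le_of_eq ?_))
  rw [← Real.exp_add, ← Real.exp_add, hs]
  congr 1
  field_simp
  ring

end McDiarmid

/-! ### Bounded classes of losses, symmetrization and the uniform bound -/

theorem _root_.MeasureTheory.MeasurePreserving.integral_comp_of_aemeasurable {α β : Type*}
    [MeasurableSpace α] [MeasurableSpace β] {μ : Measure α} {ν : Measure β} {f : α → β}
    (hf : MeasurePreserving f μ ν) {g : β → ℝ} (hg : AEMeasurable g ν) :
    ∫ x, g (f x) ∂μ = ∫ y, g y ∂ν := by
  rw [← hf.map_eq] at hg ⊢
  exact (integral_map hf.aemeasurable hg.aestronglyMeasurable).symm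

theorem _root_.MeasureTheory.MeasurePreserving.aemeasurable_comp {α β : Type*}
    [MeasurableSpace α] [MeasurableSpace β] {μ : Measure α} {ν : Measure β} {f : α → β}
    (hf : MeasurePreserving f μ ν) {g : β → ℝ} (hg : AEMeasurable g ν) :
    AEMeasurable (fun x => g (f x)) μ :=
  hg.comp_quasiMeasurePreserving hf.quasiMeasurePreserving

variable {Z ι : Type*}

/-- The supremum over a class of losses of a weighted sum of losses on a sample. -/
def supSum (ℓ : ι → Z → ℝ) {κ : Type*} [Fintype κ] (a : κ → ℝ) (z : κ → Z) : ℝ :=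
  ⨆ f, ∑ i, a i * ℓ f (z i)

theorem supSum_comp_equiv (ℓ : ι → Z → ℝ) {κ κ' : Type*} [Fintype κ] [Fintype κ']
    (e : κ ≃ κ') (a : κ' → ℝ) (z : κ' → Z) :
    supSum ℓ (fun i => a (e i)) (fun i => z (e i)) = supSum ℓ a z := by
  unfold supSum
  congr 1
  funext f
  exact e.sum_comp fun i => a i * ℓ f (z i)

/-- The weights of the difference of the empirical risks of two samples of size `n`. -/
def ghostWeight (n : ℕ) : Fin n ⊕ Fin n → ℝ :=
  Sum.elim (fun _ => -(1 / (n : ℝ))) (fun _ => 1 / (n : ℝ))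

theorem sum_ghostWeight_mul (ℓ : ι → Z → ℝ) {n : ℕ} (f : ι) (z z' : Fin n → Z) :
    ∑ i, ghostWeight n i * ℓ f (Sum.elim z z' i) =
      (1 / (n : ℝ)) * ∑ i, ℓ f (z' i) - (1 / (n : ℝ)) * ∑ i, ℓ f (z i) := by
  rw [Fintype.sum_sum_type]
  simp only [ghostWeight, Sum.elim_inl, Sum.elim_inr, ← Finset.mul_sum]
  ring

variable [MeasurableSpace Z]

/-- Reindexing an i.i.d. sample. -/
theorem measurePreserving_comp_equiv (D : Measure Z) [IsProbabilityMeasure D] {κ κ' : Type*}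
    [Fintype κ] [Fintype κ'] (e : κ ≃ κ') :
    MeasurePreserving (fun (z : κ' → Z) i => z (e i)) (Measure.pi fun _ => D)
      (Measure.pi fun _ => D) := by
  have h := measurePreserving_piCongrLeft (α := fun _ : κ => Z) (fun _ => D) e.symm
  convert! h using 1
  ext z i
  obtain ⟨j, rfl⟩ := e.symm.surjective i
  rw [MeasurableEquiv.coe_piCongrLeft, Equiv.piCongrLeft_apply_apply]
  simp

theorem measurePreserving_sumElim (D : Measure Z) [IsProbabilityMeasure D] (κ κ' : Type*)
    [Fintype κ] [Fintype κ'] :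
    MeasurePreserving (fun p : (κ → Z) × (κ' → Z) => Sum.elim p.1 p.2)
      ((Measure.pi fun _ => D).prod (Measure.pi fun _ => D)) (Measure.pi fun _ => D) := by
  have h := measurePreserving_sumPiEquivProdPi_symm (X := fun _ : κ ⊕ κ' => Z) (fun _ => D)
  convert! h using 1

/-- A class of losses with values in `[0, b]` that satisfies the usual measurability
requirements. -/
structure IsBoundedClass (D : Measure Z) (ℓ : ι → Z → ℝ) (b : ℝ) : Prop where
  nonneg : ∀ f z, 0 ≤ ℓ f z
  le : ∀ f z, ℓ f z ≤ b
  aemeasurable : ∀ f, AEMeasurable (ℓ f) D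
  aemeasurable_supSum_fin : ∀ (m : ℕ) (a : Fin m → ℝ),
    AEMeasurable (supSum ℓ a) (Measure.pi fun _ => D)

/-- The expected Rademacher complexity of a class of losses. -/
def radComplexity (D : Measure Z) (ℓ : ι → Z → ℝ) (n : ℕ) : ℝ :=
  (1 / (2 : ℝ) ^ n) * ∑ σ : Fin n → ℤˣ,
    ∫ z, supSum ℓ (fun i => ((σ i : ℤ) : ℝ) / n) z ∂(Measure.pi fun _ => D)

namespace IsBoundedClass

section

variable {D : Measure Z} {ℓ : ι → Z → ℝ} {b : ℝ} {κ : Type*} [Fintype κ]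

theorem abs_sum_le (h : IsBoundedClass D ℓ b) (a : κ → ℝ) (z : κ → Z) (f : ι) :
    |∑ i, a i * ℓ f (z i)| ≤ (∑ i, |a i|) * b := by
  refine (Finset.abs_sum_le_sum_abs _ _).trans ?_
  rw [Finset.sum_mul]
  refine Finset.sum_le_sum fun i _ => ?_
  rw [abs_mul, abs_of_nonneg (h.nonneg f (z i))]
  exact mul_le_mul_of_nonneg_left (h.le f _) (abs_nonneg _)

theorem le_supSum (h : IsBoundedClass D ℓ b) (a : κ → ℝ) (z : κ → Z) (f : ι) :
    ∑ i, a i * ℓ f (z i) ≤ supSum ℓ a z :=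
  le_ciSup (f := fun f => ∑ i, a i * ℓ f (z i))
    ⟨(∑ i, |a i|) * b, by rintro _ ⟨f, rfl⟩; exact (abs_le.1 (h.abs_sum_le a z f)).2⟩ f

variable [Nonempty ι]

theorem supSum_mem_Icc (h : IsBoundedClass D ℓ b) (a : κ → ℝ) (z : κ → Z) :
    supSum ℓ a z ∈ Set.Icc (-((∑ i, |a i|) * b)) ((∑ i, |a i|) * b) :=
  ⟨(abs_le.1 (h.abs_sum_le a z (Classical.arbitrary ι))).1.trans (h.le_supSum a z _),
    ciSup_le fun f => (abs_le.1 (h.abs_sum_le a z f)).2⟩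

/-- Changing one sample point changes the supremum by at most the range of its summand. -/
theorem supSum_update_le [DecidableEq κ] (h : IsBoundedClass D ℓ b) (a : κ → ℝ) (z : κ → Z)
    (i : κ) (y : Z) : supSum ℓ a (Function.update z i y) ≤ supSum ℓ a z + |a i| * b := by
  refine ciSup_le fun f => ?_
  have h1 : ∑ j, a j * ℓ f (Function.update z i y j) - ∑ j, a j * ℓ f (z j) =
      a i * (ℓ f y - ℓ f (z i)) := by
    rw [← Finset.sum_sub_distrib, Finset.sum_eq_single i]
    · simp; ring
    · intro j _ hj; simp [Function.update_of_ne hj]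
    · simp
  have h2 : a i * (ℓ f y - ℓ f (z i)) ≤ |a i| * b := by
    refine (le_abs_self _).trans ?_
    rw [abs_mul]
    refine mul_le_mul_of_nonneg_left ?_ (abs_nonneg _)
    rw [abs_le]
    constructor <;> linarith [h.nonneg f y, h.nonneg f (z i), h.le f y, h.le f (z i)]
  linarith [h.le_supSum a z f]

/-- The supremum of a sum over two samples is subadditive. -/
theorem supSum_sum_le {κ' : Type*} [Fintype κ'] (h : IsBoundedClass D ℓ b) (a : κ ⊕ κ' → ℝ)
    (z : κ → Z) (z' : κ' → Z) :
    supSum ℓ a (Sum.elim z z') ≤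
      supSum ℓ (fun i => a (.inl i)) z + supSum ℓ (fun i => a (.inr i)) z' := by
  refine ciSup_le fun f => ?_
  rw [Fintype.sum_sum_type]
  exact add_le_add (h.le_supSum (fun i => a (.inl i)) z f) (h.le_supSum (fun i => a (.inr i)) z' f)

end

variable {D : Measure Z} [IsProbabilityMeasure D] {ℓ : ι → Z → ℝ} {b : ℝ} {κ : Type*} [Fintype κ]

/-- Enumerating the index type reduces to `Fin m`; the case needed later is the double sample `Fin n
⊕ Fin n`. -/
theorem aemeasurable_supSum (h : IsBoundedClass D ℓ b) (a : κ → ℝ) :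
    AEMeasurable (supSum ℓ a) (Measure.pi fun _ => D) := by
  let e := (Fintype.equivFin κ).symm
  refine ((measurePreserving_comp_equiv D e).aemeasurable_comp
    (h.aemeasurable_supSum_fin _ fun i => a (e i))).congr (.of_forall fun z => ?_)
  exact supSum_comp_equiv ℓ e a z

/-- An i.i.d. sample is exchangeable, so permuting the weights amounts to permuting the points. -/
theorem integral_supSum_comp_equiv (h : IsBoundedClass D ℓ b) {κ' : Type*} [Fintype κ']
    (e : κ ≃ κ') (a : κ' → ℝ) :
    ∫ z, supSum ℓ (fun i => a (e i)) z ∂(Measure.pi fun _ => D) =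
      ∫ z, supSum ℓ a z ∂(Measure.pi fun _ => D) := by
  rw [← (measurePreserving_comp_equiv D e).integral_comp_of_aemeasurable
    (h.aemeasurable_supSum fun i => a (e i))]
  exact integral_congr_ae (.of_forall fun z => supSum_comp_equiv ℓ e a z)

variable [Nonempty ι]

theorem integrable_supSum (h : IsBoundedClass D ℓ b) (a : κ → ℝ) :
    Integrable (supSum ℓ a) (Measure.pi fun _ => D) :=
  Integrable.of_mem_Icc _ _ (h.aemeasurable_supSum a) (.of_forall fun z => h.supSum_mem_Icc a z)

theorem integral_supSum_sum_le {κ' : Type*} [Fintype κ'] (h : IsBoundedClass D ℓ b)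
    (a : κ ⊕ κ' → ℝ) :
    ∫ z, supSum ℓ a z ∂(Measure.pi fun _ => D) ≤
      ∫ z, supSum ℓ (fun i => a (.inl i)) z ∂(Measure.pi fun _ => D) +
      ∫ z, supSum ℓ (fun i => a (.inr i)) z ∂(Measure.pi fun _ => D) := by
  have hmp := measurePreserving_sumElim D κ κ'
  have h1 := (h.integrable_supSum fun i => a (.inl i)).comp_fst (Measure.pi fun _ : κ' => D)
  have h2 := (h.integrable_supSum fun i => a (.inr i)).comp_snd (Measure.pi fun _ : κ => D)
  rw [← hmp.integral_comp_of_aemeasurable (h.aemeasurable_supSum a),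
    ← (measurePreserving_fst (μ := Measure.pi fun _ : κ => D)
      (ν := Measure.pi fun _ : κ' => D)).integral_comp_of_aemeasurable
      (h.aemeasurable_supSum fun i => a (.inl i)),
    ← (measurePreserving_snd (μ := Measure.pi fun _ : κ => D)
      (ν := Measure.pi fun _ : κ' => D)).integral_comp_of_aemeasurable
      (h.aemeasurable_supSum fun i => a (.inr i)),
    ← integral_add h1 h2]
  refine integral_mono_ae ?_ (h1.add h2) (.of_forall fun p => h.supSum_sum_le a p.1 p.2)
  exact Integrable.of_mem_Icc _ _ (hmp.aemeasurable_comp (h.aemeasurable_supSum a))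
    (.of_forall fun p => h.supSum_mem_Icc a _)

end IsBoundedClass

/-- Swapping the two copies of the sample points whose sign is `-1`. -/
def signSwap {n : ℕ} (σ : Fin n → ℤˣ) : Equiv.Perm (Fin n ⊕ Fin n) :=
  Function.Involutive.toPerm
    (Sum.elim (fun i => if σ i = 1 then .inl i else .inr i)
      (fun i => if σ i = 1 then .inr i else .inl i)) (by
    rintro (i | i) <;> by_cases h : σ i = 1 <;> simp [h])

theorem ghostWeight_signSwap_inl {n : ℕ} (σ : Fin n → ℤˣ) (i : Fin n) :
    ghostWeight n (signSwap σ (.inl i)) = (((-σ) i : ℤˣ) : ℤ) / (n : ℝ) := by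
  rcases Int.units_eq_one_or (σ i) with h | h <;>
    simp [ghostWeight, signSwap, h, Function.Involutive.toPerm, neg_div]

theorem ghostWeight_signSwap_inr {n : ℕ} (σ : Fin n → ℤˣ) (i : Fin n) :
    ghostWeight n (signSwap σ (.inr i)) = ((σ i : ℤˣ) : ℤ) / (n : ℝ) := by
  rcases Int.units_eq_one_or (σ i) with h | h <;>
    simp [ghostWeight, signSwap, h, Function.Involutive.toPerm, neg_div]

theorem sum_abs_ghostWeight {n : ℕ} (hn : 1 ≤ n) : ∑ i, |ghostWeight n i| = 2 := by
  have : (n : ℝ) ≠ 0 := by positivity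
  simp [ghostWeight]
  field_simp
  norm_num

namespace IsBoundedClass

variable {D : Measure Z} {ℓ : ι → Z → ℝ} {b : ℝ}

/-- The supremum over the class of the difference of the empirical risks of two samples. -/
theorem ghost_mem_Icc [Nonempty ι] (h : IsBoundedClass D ℓ b) {n : ℕ} (hn : 1 ≤ n) (z : Fin n ⊕ Fin n → Z) :
    0 ≤ supSum ℓ (ghostWeight n) z + 2 * b ∧ supSum ℓ (ghostWeight n) z + 2 * b ≤ 4 * b := by
  have := h.supSum_mem_Icc (ghostWeight n) z
  rw [sum_abs_ghostWeight hn] at this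
  exact ⟨by linarith [this.1], by linarith [this.2]⟩

variable [IsProbabilityMeasure D]

/-- The empirical risk is unbiased; the constant `r` carries the empirical risk of the other sample
and the shift 2b. -/
theorem integral_mean_sub (h : IsBoundedClass D ℓ b) {n : ℕ} (hn : 1 ≤ n) (f : ι) (r : ℝ) :
    AEMeasurable (fun z : Fin n → Z => (1 / (n : ℝ)) * ∑ i, ℓ f (z i) + r)
      (Measure.pi fun _ => D) ∧
    ∫ z : Fin n → Z, ((1 / (n : ℝ)) * ∑ i, ℓ f (z i) + r) ∂(Measure.pi fun _ => D) =
      ∫ z, ℓ f z ∂D + r := by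
  have hn0 : (n : ℝ) ≠ 0 := by positivity
  have hmp : ∀ i : Fin n, MeasurePreserving (fun z : Fin n → Z => z i)
      (Measure.pi fun _ => D) D := fun i => measurePreserving_eval (fun _ => D) i
  have hm : ∀ i : Fin n, AEMeasurable (fun z : Fin n → Z => ℓ f (z i)) (Measure.pi fun _ => D) :=
    fun i => (hmp i).aemeasurable_comp (h.aemeasurable f)
  have hi : ∀ i : Fin n, Integrable (fun z : Fin n → Z => ℓ f (z i)) (Measure.pi fun _ => D) :=
    fun i => Integrable.of_mem_Icc 0 b (hm i) (.of_forall fun z => ⟨h.nonneg f _, h.le f _⟩)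
  refine ⟨((Finset.aemeasurable_fun_sum _ fun i _ => hm i).const_mul _).add_const _, ?_⟩
  rw [integral_add ((integrable_finsetSum _ fun i _ => hi i).const_mul _) (integrable_const _),
    integral_const_mul, integral_finsetSum _ fun i _ => hi i,
    Finset.sum_congr rfl fun i _ => (hmp i).integral_comp_of_aemeasurable (h.aemeasurable f)]
  simp [hn0]

variable [Nonempty ι]

/-- **Symmetrization**. -/
theorem integral_ghost_le (h : IsBoundedClass D ℓ b) (n : ℕ) :
    ∫ z, supSum ℓ (ghostWeight n) z ∂(Measure.pi fun _ => D) ≤ 2 * radComplexity D ℓ n := by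
  set I : (Fin n → ℤˣ) → ℝ := fun σ =>
    ∫ z, supSum ℓ (fun i => ((σ i : ℤ) : ℝ) / n) z ∂(Measure.pi fun _ => D) with hI
  set J := ∫ z, supSum ℓ (ghostWeight n) z ∂(Measure.pi fun _ => D) with hJ
  -- Swapping copies according to σ leaves the mean unchanged and turns the weights into −σᵢ/n on
  -- one sample and σᵢ/n on the other. Averaging over σ makes the two terms equal, because −σ is
  -- again a uniform sign vector.
  have h1 : ∀ σ, J ≤ I (-σ) + I σ := by
    intro σ
    have h2 := h.integral_supSum_sum_le fun i => ghostWeight n (signSwap σ i)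
    rw [h.integral_supSum_comp_equiv (signSwap σ)] at h2
    simpa only [ghostWeight_signSwap_inl, ghostWeight_signSwap_inr] using h2
  have h3 : ∑ _σ : Fin n → ℤˣ, J ≤ ∑ σ, (I (-σ) + I σ) := Finset.sum_le_sum fun σ _ => h1 σ
  have h4 : ∑ σ, I (-σ) = ∑ σ, I σ := Equiv.sum_comp (Equiv.neg (Fin n → ℤˣ)) I
  rw [Finset.sum_add_distrib, h4, Finset.sum_const, Finset.card_univ, nsmul_eq_mul] at h3
  have h5 : ((Fintype.card (Fin n → ℤˣ) : ℕ) : ℝ) = 2 ^ n := by simp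
  rw [h5] at h3
  have h6 : 2 * radComplexity D ℓ n = (2 * ∑ σ, I σ) / 2 ^ n := by
    rw [radComplexity]; ring
  rw [h6, le_div_iff₀ (by positivity)]
  linarith

/-- The uniform deviation of the risks from the empirical risks is bounded by the mean over a
ghost sample. -/
theorem risk_sub_le_lowerMean (h : IsBoundedClass D ℓ b) {n : ℕ} (hn : 1 ≤ n) (f : ι)
    (z : Fin n → Z) :
    ∫ x, ℓ f x ∂D - (1 / (n : ℝ)) * ∑ i, ℓ f (z i) + 2 * b ≤
      lowerMean (Measure.pi fun _ => D)
        fun z' => supSum ℓ (ghostWeight n) (Sum.elim z z') + 2 * b := by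
  obtain ⟨h1, h2⟩ := h.integral_mean_sub hn f (-((1 / (n : ℝ)) * ∑ i, ℓ f (z i)) + 2 * b)
  have hle : ∀ z' : Fin n → Z,
      (1 / (n : ℝ)) * ∑ i, ℓ f (z' i) + (-((1 / (n : ℝ)) * ∑ i, ℓ f (z i)) + 2 * b) ≤
        supSum ℓ (ghostWeight n) (Sum.elim z z') + 2 * b := by
    intro z'
    have h3 := h.le_supSum (ghostWeight n) (Sum.elim z z') f
    rw [sum_ghostWeight_mul] at h3
    linarith
  have h0 : ∀ z' : Fin n → Z,
      0 ≤ (1 / (n : ℝ)) * ∑ i, ℓ f (z' i) + (-((1 / (n : ℝ)) * ∑ i, ℓ f (z i)) + 2 * b) := by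
    intro z'
    have h3 := h.abs_sum_le (ghostWeight n) (Sum.elim z z') f
    rw [sum_abs_ghostWeight hn, sum_ghostWeight_mul] at h3
    linarith [(abs_le.1 h3).1]
  have h4 := lowerMean_le_add (μ := Measure.pi fun _ : Fin n => D) (c := 0)
    (fun z' => (h.ghost_mem_Icc hn (Sum.elim z z')).1)
    (fun z' => (h.ghost_mem_Icc hn (Sum.elim z z')).2) le_rfl (fun z' => (hle z').trans (add_zero _).ge)
  rw [lowerMean_eq_integral h0 h1, h2] at h4
  linarith

/-- The one-sided **uniform generalization bound** in terms of the Rademacher complexity. -/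
theorem exists_uniform_bound (h : IsBoundedClass D ℓ b) {n : ℕ} (hn : 1 ≤ n) {δ : ℝ}
    (hδ : 0 < δ) (hδ1 : δ < 1) :
    ∃ A : Set (Fin n → Z), MeasurableSet A ∧
      ENNReal.ofReal (1 - δ) ≤ (Measure.pi fun _ => D) A ∧
      ∀ z ∈ A, ∀ f, ∫ x, ℓ f x ∂D ≤ (1 / (n : ℝ)) * ∑ i, ℓ f (z i) +
        2 * radComplexity D ℓ n + b * √(Real.log (1 / δ) / (2 * n)) := by
  have hb0 : 0 ≤ b := by
    have : Nonempty Z := nonempty_of_isProbabilityMeasure D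
    exact (h.nonneg (Classical.arbitrary ι) (Classical.arbitrary Z)).trans (h.le _ _)
  -- McDiarmid's inequality is available only for a positive difference bound, so b = 0 is separate.
  rcases hb0.eq_or_lt with rfl | hb
  · have hz : ∀ f z, ℓ f z = 0 := fun f z => le_antisymm (h.le f z) (h.nonneg f z)
    refine ⟨Set.univ, MeasurableSet.univ, ?_, fun z _ f => ?_⟩
    · rw [measure_univ, ENNReal.ofReal_le_one]
      linarith
    · simp [radComplexity, supSum, hz]
  have hn0 : (0 : ℝ) < n := by positivity
  set P : Measure (Fin n → Z) := Measure.pi fun _ => D with hP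
  -- The shift 2b makes the integrand nonnegative, as `lowerMean` needs; it cancels at the end. It
  -- does not affect the differences b/n, hence not the deviation term.
  set G : (Fin n → Z) × (Fin n → Z) → ℝ := fun p =>
    supSum ℓ (ghostWeight n) (Sum.elim p.1 p.2) + 2 * b with hG
  set g : (Fin n → Z) → ℝ := fun z => lowerMean P fun z' => G (z, z') with hg
  set t : ℝ := b * √(Real.log (1 / δ) / (2 * n)) with ht
  have hlog : 0 < Real.log (1 / δ) := Real.log_pos (by rw [lt_div_iff₀ hδ]; linarith)
  have hmp := measurePreserving_sumElim D (Fin n) (Fin n)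
  have hGm : AEMeasurable G (P.prod P) :=
    (hmp.aemeasurable_comp (h.aemeasurable_supSum (ghostWeight n))).add_const _
  have hG0 : ∀ p, 0 ≤ G p := fun p => (h.ghost_mem_Icc hn _).1
  have hGb : ∀ p, G p ≤ 4 * b := fun p => (h.ghost_mem_Icc hn _).2
  have hgm : AEMeasurable g P := aemeasurable_lowerMean hGm
  have hbd : ∀ z i y, g (Function.update z i y) ≤ g z + b / n := by
    intro z i y
    refine lowerMean_le_add (fun z' => hG0 _) (fun z' => hGb _) (by positivity) fun z' => ?_
    have h1 := h.supSum_update_le (ghostWeight n) (Sum.elim z z') (.inl i) y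
    rw [Sum.update_elim_inl] at h1
    have h2 : |ghostWeight n (.inl i)| * b = b / n := by
      simp only [ghostWeight, Sum.elim_inl, abs_neg]
      rw [abs_of_pos (by positivity)]
      ring
    simp only [hG]
    linarith
  have hmean : ∫ z, g z ∂P ≤ 2 * radComplexity D ℓ n + 2 * b := by
    rw [hg, integral_lowerMean hGm hG0 hGb, hG,
      integral_add (Integrable.of_mem_Icc _ _
        (hmp.aemeasurable_comp (h.aemeasurable_supSum (ghostWeight n)))
        (.of_forall fun p => h.supSum_mem_Icc (ghostWeight n) _)) (integrable_const _),
      hmp.integral_comp_of_aemeasurable (h.aemeasurable_supSum (ghostWeight n))]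
    simpa using h.integral_ghost_le n
  have htail := mcdiarmid D hn g hgm (fun z => lowerMean_nonneg _)
    (fun z => lowerMean_le (by positivity) fun z' => hGb _) (by positivity) hbd
    (t := t) (by positivity)
  have hexp : Real.exp (-2 * t ^ 2 / (n * (b / n) ^ 2)) = δ := by
    have h1 : -2 * t ^ 2 / (n * (b / n) ^ 2) = Real.log δ := by
      rw [ht, mul_pow, Real.sq_sqrt (by positivity), one_div, Real.log_inv]
      field_simp
    rw [h1, Real.exp_log hδ]
  rw [hexp] at htail
  set s : Set (Fin n → Z) := {z | ∫ z, g z ∂P + t ≤ g z} with hs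
  have hsm : NullMeasurableSet s P := nullMeasurableSet_le aemeasurable_const hgm
  -- The good event is only null measurable; it is shrunk to a measurable set of the same measure.
  obtain ⟨A, hAs, hA, hAe⟩ := hsm.compl.exists_measurable_subset_ae_eq
  refine ⟨A, hA, ?_, fun z hz f => ?_⟩
  · rw [measure_congr hAe, prob_compl_eq_one_sub₀ hsm, ENNReal.ofReal_sub _ hδ.le,
      ENNReal.ofReal_one]
    refine tsub_le_tsub_left ?_ _
    rw [← ofReal_measureReal]
    exact ENNReal.ofReal_le_ofReal htail
  · have h1 : g z < ∫ z, g z ∂P + t := not_le.1 (hAs hz)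
    have h2 := h.risk_sub_le_lowerMean hn f z
    change _ ≤ g z at h2
    linarith

end IsBoundedClass

/-! ### Complexity of classes with few restrictions -/

namespace IsBoundedClass

variable {Z ι : Type*} [MeasurableSpace Z] [Nonempty ι] {D : Measure Z} [IsProbabilityMeasure D]
  {ℓ : ι → Z → ℝ} {b : ℝ}

theorem radComplexity_eq (h : IsBoundedClass D ℓ b) (n : ℕ) :
    radComplexity D ℓ n = ∫ z : Fin n → Z, (1 / (2 : ℝ) ^ n) * ∑ σ : Fin n → ℤˣ,
      supSum ℓ (fun i => ((σ i : ℤ) : ℝ) / n) z ∂(Measure.pi fun _ => D) := by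
  rw [integral_const_mul, integral_finsetSum _ fun σ _ => h.integrable_supSum _]
  rfl

/-- The Rademacher complexity of a class with at most `N` restrictions to every sample. -/
theorem radComplexity_le (h : IsBoundedClass D ℓ b) {n : ℕ} (hn : 1 ≤ n) {N : ℝ}
    (hN : ∀ z : Fin n → Z, (Set.range fun f i => ℓ f (z i) / n).Finite ∧
      ((Set.range fun f i => ℓ f (z i) / n).ncard : ℝ) ≤ N) :
    radComplexity D ℓ n ≤ √(2 * Real.log N * (b ^ 2 / n)) := by
  have hn0 : (0 : ℝ) < n := by positivity
  rw [h.radComplexity_eq]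
  have hint : Integrable (fun z : Fin n → Z => (1 / (2 : ℝ) ^ n) * ∑ σ : Fin n → ℤˣ,
      supSum ℓ (fun i => ((σ i : ℤ) : ℝ) / n) z) (Measure.pi fun _ => D) :=
    (integrable_finsetSum _ fun σ _ => h.integrable_supSum _).const_mul _
  refine (integral_mono hint (integrable_const (√(2 * Real.log N * (b ^ 2 / n)))) fun z => ?_).trans
    (by simp)
  have hm := massart (fun f i => ℓ f (z i) / n) (hN z).1 (hN z).2 (B := b ^ 2 / n) fun f => by
    calc ∑ i, (ℓ f (z i) / n) ^ 2 ≤ ∑ _i : Fin n, (b / n) ^ 2 := by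
          refine Finset.sum_le_sum fun i _ => ?_
          have := h.nonneg f (z i)
          have := h.le f (z i)
          gcongr
      _ = b ^ 2 / n := by
          rw [Finset.sum_const, Finset.card_univ, Fintype.card_fin, nsmul_eq_mul]
          field_simp
  refine le_trans (le_of_eq ?_) hm
  congr 1
  refine Finset.sum_congr rfl fun σ _ => ?_
  unfold supSum
  congr 1
  funext f
  exact Finset.sum_congr rfl fun i _ => by ring

end IsBoundedClass

/-! ### The SPO losses as a bounded class -/

variable {d : ℕ} {S C : Set (Vec d)} {w : Vec d → Vec d}

theorem IsOracle.loss_nonneg (hw : IsOracle S w) (c' c : Vec d) : 0 ≤ loss w c' c := by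
  rw [loss, inner_sub_right]
  exact sub_nonneg.2 ((hw c).2 _ (hw c').1)

theorem IsOracle.loss_le_gapSup (hw : IsOracle S w) (hS : IsCompact S)
    (hbdd : BddAbove (gap S '' C)) (c' : Vec d) {c : Vec d} (hc : c ∈ C) :
    loss w c' c ≤ gapSup S C := by
  have hcpt : IsCompact ((fun v => inner ℝ c v) '' S) :=
    hS.image (continuous_const.inner continuous_id)
  refine le_trans ?_ (le_csSup hbdd ⟨c, hc, rfl⟩)
  rw [loss, inner_sub_right, gap]
  exact sub_le_sub (le_csSup hcpt.bddAbove ⟨_, (hw c').1, rfl⟩)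
    (csInf_le hcpt.bddBelow ⟨_, (hw c).1, rfl⟩)

variable {X : Type*}

/-- The SPO losses of a hypothesis class, set to zero outside of the set `K`. -/
def lossOn (w : Vec d → Vec d) (H : Set (X → Vec d)) (K : Set (X × Vec d)) (f : H) :
    X × Vec d → ℝ :=
  K.indicator fun z => loss w (f.1 z.1) z.2

theorem lossOn_of_mem (H : Set (X → Vec d)) {K : Set (X × Vec d)} (f : H) {z : X × Vec d}
    (hz : z ∈ K) : lossOn w H K f z = loss w (f.1 z.1) z.2 :=
  Set.indicator_of_mem hz _

/-- The restrictions of the losses to a sample are counted by those of the decision class. -/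
theorem ncard_range_lossOn_le {H : Set (X → Vec d)} {E : Set (Vec d)} (hEfin : E.Finite)
    (hEne : E.Nonempty) (hE : ∀ f ∈ H, ∀ x, w (f x) ∈ E)
    (hdim : natarajanDim (decisionClass w H) ≠ ⊤) (K : Set (X × Vec d)) {n : ℕ} (hn : 1 ≤ n)
    (z : Fin n → X × Vec d) :
    (Set.range fun (f : H) i => lossOn w H K f (z i) / n).Finite ∧
    ((Set.range fun (f : H) i => lossOn w H K f (z i) / n).ncard : ℝ) ≤
      ((n : ℝ) * (E.ncard : ℝ) ^ 2) ^ (natarajanDim (decisionClass w H)).toNat := by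
  obtain ⟨hfin, hcard⟩ := ncard_image_comp_le (F := decisionClass w H) hEfin
    (by rintro _ ⟨f, hf, rfl⟩ x; exact hE f hf x) hEne hdim hn fun i => (z i).1
  -- Each loss vector is the image of the decision vector `u` = (w (f xᵢ))ᵢ under a map that depends
  -- only on the sample.
  have hsub : (Set.range fun (f : H) i => lossOn w H K f (z i) / n) ⊆
      (fun (u : Fin n → Vec d) i =>
        K.indicator (fun _ => inner ℝ (z i).2 (u i - w (z i).2)) (z i) / n) ''
        ((fun g : X → Vec d => g ∘ fun i => (z i).1) '' decisionClass w H) := by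
    rintro _ ⟨f, rfl⟩
    refine ⟨_, ⟨_, ⟨f.1, f.2, rfl⟩, rfl⟩, ?_⟩
    funext i
    by_cases hi : z i ∈ K <;> simp [lossOn, loss, hi]
  refine ⟨(hfin.image _).subset hsub, ?_⟩
  have h := ((Set.ncard_le_ncard hsub (hfin.image _)).trans (Set.ncard_image_le hfin)).trans hcard
  exact_mod_cast h

variable [MeasurableSpace X]

theorem ae_sampleLaw_forall_mem {D : Measure (X × Vec d)} [IsProbabilityMeasure D]
    {K : Set (X × Vec d)} (hK : K ∈ ae D) (n : ℕ) : ∀ᵐ z ∂(sampleLaw D n), ∀ i, z i ∈ K :=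
  Filter.eventually_all.2 fun _ => Measure.tendsto_eval_ae_ae.eventually hK

/-- Almost every sample lies entirely in `K`, where truncated and true losses agree for all `f` at
once; hence their suprema agree a.e. and measurability transfers. Off `K` the upper bound needs 0 ≤
`gapSup S C`, which any point of `K` supplies. -/
theorem isBoundedClass_lossOn (hw : IsOracle S w) (hS : IsCompact S)
    (hbdd : BddAbove (gap S '' C)) {H : Set (X → Vec d)} {D : Measure (X × Vec d)}
    [IsProbabilityMeasure D] (hmeas : IsMeasurableClass D w H) {K : Set (X × Vec d)}
    (hK : K ∈ ae D) (hKm : MeasurableSet K) (hKC : ∀ z ∈ K, z.2 ∈ C) :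
    IsBoundedClass D (lossOn w H K) (gapSup S C) where
  nonneg f z := Set.indicator_nonneg (fun z _ => hw.loss_nonneg _ _) z
  le f z := by
    have : K.Nonempty := by
      rw [Set.nonempty_iff_ne_empty]
      rintro rfl
      have := nonempty_of_isProbabilityMeasure D
      simp at hK
    obtain ⟨p, hp⟩ := this
    exact Set.indicator_le' (fun z hz => hw.loss_le_gapSup hS hbdd _ (hKC z hz))
      (fun _ _ => (hw.loss_nonneg 0 p.2).trans (hw.loss_le_gapSup hS hbdd _ (hKC p hp))) z
  aemeasurable f := (hmeas.1 f.1 f.2).indicator hKm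
  aemeasurable_supSum_fin m a := by
    refine (hmeas.2 m a).congr ?_
    filter_upwards [ae_sampleLaw_forall_mem hK m] with z hz
    unfold supSum
    simp only [fun f i => lossOn_of_mem (w := w) H f (hz i)]

theorem rademacher_eq_radComplexity {H : Set (X → Vec d)} [Nonempty H] {D : Measure (X × Vec d)}
    [IsProbabilityMeasure D] {K : Set (X × Vec d)} {b : ℝ}
    (h : IsBoundedClass D (lossOn w H K) b) (hK : K ∈ ae D) (n : ℕ) :
    rademacher D w H n = radComplexity D (lossOn w H K) n := by
  rw [h.radComplexity_eq]
  refine integral_congr_ae ?_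
  filter_upwards [ae_sampleLaw_forall_mem hK n] with z hz
  unfold empRademacher supSum
  simp only [fun f i => lossOn_of_mem (w := w) H f (hz i), Finset.mul_sum]
  congr! 5
  ring

end SPO

end

/-! ### The two bounds -/

theorem theorem2 {d : ℕ} {X : Type*} [MeasurableSpace X]
    (S C : Set (SPO.Vec d)) (hpoly : SPO.IsPolyhedron S) (hne : S.Nonempty)
    (hcomp : IsCompact S)
    (w : SPO.Vec d → SPO.Vec d) (hw : SPO.IsOracle S w)
    (H : Set (X → SPO.Vec d))
    -- the induced decision class consists of maps into the set of extreme points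
    (hext : ∀ f ∈ H, ∀ x, w (f x) ∈ S.extremePoints ℝ)
    (D : MeasureTheory.Measure (X × SPO.Vec d)) [MeasureTheory.IsProbabilityMeasure D]
    (hC : ∀ᵐ z ∂D, z.2 ∈ C)
    (hbdd : BddAbove (SPO.gap S '' C))
    (hmeas : SPO.IsMeasurableClass D w H)
    (hdim : SPO.natarajanDim (SPO.decisionClass w H) ≠ ⊤)
    (n : ℕ) (hn : 1 ≤ n) :
    SPO.rademacher D w H n ≤
      SPO.gapSup S C *
        Real.sqrt (2 * ((SPO.natarajanDim (SPO.decisionClass w H)).toNat : ℝ) *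
          Real.log ((n : ℝ) * ((S.extremePoints ℝ).ncard : ℝ) ^ 2) / (n : ℝ)) ∧
    ∀ δ : ℝ, 0 < δ →
      ∃ A : Set (Fin n → X × SPO.Vec d), MeasurableSet A ∧
        ENNReal.ofReal (1 - δ) ≤ SPO.sampleLaw D n A ∧
        ∀ z ∈ A, ∀ f ∈ H,
          SPO.risk D w f ≤ SPO.empRisk w f z +
            2 * (SPO.gapSup S C *
              Real.sqrt (2 * ((SPO.natarajanDim (SPO.decisionClass w H)).toNat : ℝ) *
                Real.log ((n : ℝ) * ((S.extremePoints ℝ).ncard : ℝ) ^ 2) / (n : ℝ))) +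
            SPO.gapSup S C * Real.sqrt (Real.log (1 / δ) / (2 * (n : ℝ))) := by
  obtain ⟨K, hK, hKm, hKC⟩ := hC.exists_measurable_mem
  have h := SPO.isBoundedClass_lossOn hw hcomp hbdd hmeas hK hKm hKC
  obtain ⟨p⟩ : Nonempty (X × SPO.Vec d) := MeasureTheory.nonempty_of_isProbabilityMeasure D
  have hb : 0 ≤ SPO.gapSup S C := by
    obtain ⟨q, hq⟩ := hC.exists
    exact (hw.loss_nonneg 0 q.2).trans (hw.loss_le_gapSup hcomp hbdd _ hq)
  rcases H.eq_empty_or_nonempty with rfl | hH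
  -- For empty `H` the real supremum over the empty type is 0, so the complexity vanishes.
  · refine ⟨?_, fun δ hδ => ⟨Set.univ, MeasurableSet.univ, ?_, by simp⟩⟩
    · have h0 : SPO.rademacher D w ∅ n = 0 := by
        simp [SPO.rademacher, SPO.empRademacher, Real.iSup_of_isEmpty]
      rw [h0]
      positivity
    · rw [SPO.sampleLaw, MeasureTheory.measure_univ, ENNReal.ofReal_le_one]
      linarith
  have : Nonempty H := hH.to_subtype
  obtain ⟨f₀, hf₀⟩ := hH
  have hrad : SPO.radComplexity D (SPO.lossOn w H K) n ≤ SPO.gapSup S C *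
      Real.sqrt (2 * ((SPO.natarajanDim (SPO.decisionClass w H)).toNat : ℝ) *
        Real.log ((n : ℝ) * ((S.extremePoints ℝ).ncard : ℝ) ^ 2) / (n : ℝ)) := by
    refine (h.radComplexity_le hn (SPO.ncard_range_lossOn_le hpoly.finite_extremePoints
      ⟨_, hext f₀ hf₀ p.1⟩ hext hdim K hn)).trans (le_of_eq ?_)
    -- The logarithm brings the exponent d_N down as a factor, and ω is moved under the root as ω².
    rw [Real.log_pow]
    conv_rhs => rw [← Real.sqrt_sq hb, ← Real.sqrt_mul (sq_nonneg _)]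
    congr 1
    ring
  refine ⟨(SPO.rademacher_eq_radComplexity h hK n).trans_le hrad, fun δ hδ => ?_⟩
  rcases le_or_gt 1 δ with hδ1 | hδ1
  · exact ⟨∅, MeasurableSet.empty, by simp [hδ1], by simp⟩
  obtain ⟨A, hA, hAδ, hAb⟩ := h.exists_uniform_bound hn hδ hδ1
  have hKall : MeasurableSet {z : Fin n → X × SPO.Vec d | ∀ i, z i ∈ K} := by
    simp only [Set.ofPred_forall]
    exact MeasurableSet.iInter fun i => measurable_pi_apply i hKm
  -- Restricting to samples inside `K` costs no probability and makes the truncated empirical risk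
  -- the true one.
  refine ⟨A ∩ {z | ∀ i, z i ∈ K}, hA.inter hKall, ?_, fun z hz f hf => ?_⟩
  · refine hAδ.trans_eq (MeasureTheory.measure_inter_conull ?_).symm
    exact SPO.ae_sampleLaw_forall_mem hK n
  · have h1 := hAb z hz.1 ⟨f, hf⟩
    have h2 : ∫ x, SPO.lossOn w H K ⟨f, hf⟩ x ∂D = SPO.risk D w f := by
      refine MeasureTheory.integral_congr_ae ?_
      filter_upwards [hK] with x hx
      exact SPO.lossOn_of_mem H ⟨f, hf⟩ hx
    rw [h2, Finset.sum_congr rfl fun i _ => SPO.lossOn_of_mem H ⟨f, hf⟩ (hz.2 i)] at h1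
    rw [SPO.empRisk]
    linarith
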